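/- Let $B_j$ be the Bernoulli numbers, $\frac{z}{e^z-1}=\sum_{j\ge 0}B_j\frac{z^j}{j!}$ (so $B_1=-\tfrac12$). Let $r\ge 1$ and let $n_1,\dots,n_r\ge 0$ be integers; put $\tilde n=n_1+\dots+n_r$. Let $\mathcal B_2,\dots,\mathcal B_r$ be independent Bernoulli symbols, i.e. a polynomial in them is evaluated linearly by $\prod_k\mathcal B_k^{j_k}\mapsto\prod_k B_{j_k}$. Evaluate polynomials in the symbols $\mathcal H_1(\infty),\mathcal H_{1,2}(\infty),\dots,\mathcal H_{1,\dots,r}(\infty)$ linearly by the following rules, applied to the symbol of largest depth first: - for $k\ge 2$, a power $\mathcal H_{1,\dots,k}^{m}(\infty)$ ($m\ge 0$) is replaced by $\dfrac{(\mathcal B_k+\mathcal H_{1,\dots,k-1}(\infty))^{m+1}}{m+1}$; - for $k=1$, $\mathcal H_1^m(\infty)=\dfrac{B_{m+1}}{m+1}$. Define $H_{-n_1,\dots,-n_r}(\infty):=\prod_{k=1}^r\mathcal H_{1,\dots,k}^{n_k}(\infty)$. Then $$H_{-n_1,\dots,-n_r}(\infty)=(-1)^{\tilde n}\,\zeta(-n_1,\dots,-n_r),$$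 where $\zeta(-n_1,\dots,-n_r)$ is the value given by Raabe's analytic continuation, $$\zeta(-n_1,\dots,-n_r)=(-1)^{\tilde n}\sum_{k_2,\dots,k_r}\frac{B_{N_1}}{N_1}\prod_{j=2}^r\binom{N_j}{k_j}\frac{B_{k_j}}{N_j},\qquad N_j=\sum_{i=j}^r n_i+(r-j+1)-\sum_{i=j+1}^r k_i ,$$ the sum being over all integers $k_2,\dots,k_r$ with $0\le k_j\le N_j$ for $2\le j\le r$. Moreover, this number is a value of the analytic continuation of the multiple zeta function $$\zeta(s_1,\dots,s_r)=\sum_{0<k_1<\dots<k_r}k_1^{-s_1}\cdots k_r^{-s_r}$$ at $(-n_1,\dots,-n_r)$, namely the one (which exists and is unique) obtained by continuing in one variable after the other: for $s_1,\dots,s_{r-1}$ of large real part continue meromorphically in $s_r$ from large real part to a half-plane containing $-n_r$ and take the value at $s_r=-n_r$, where the continuation is holomorphic; continue the resulting function of $(s_1,\dots,s_{r-1})$ in the same way in $s_{r-1}$ to $s_{r-1}=-n_{r-1}$; and so on, down to $s_1=-n_1$. -/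

import Mathlib

open scoped BigOperators

noncomputable section

/-- The evaluation rule `𝓑 ^ j ↦ B_j` of the Bernoulli symbol, extended linearly to polynomials in
the symbol with coefficients in a commutative `ℚ`-algebra `R`. Here `B_j` is defined by
`z / (e ^ z - 1) = ∑ B_j z ^ j / j!`, so that `B_1 = -1/2`. -/
def bernoulliEval {R : Type*} [CommRing R] [Algebra ℚ R] (p : Polynomial R) : R :=
  ∑ j ∈ p.support, bernoulli j • p.coeff j

/-- The renormalized evaluation of a polynomial in the `d + 1` symbols
`𝓗_1(∞), 𝓗_{1,2}(∞), …, 𝓗_{1,…,d+1}(∞)`, the variable `X k` standing for `𝓗_{1,…,k+1}(∞)`.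
It is linear and is given on monomials as follows.
* If `𝓗_1` is the only symbol, then `𝓗_1 ^ n ↦ B_{n+1} / (n+1)`.
* Otherwise the power `𝓗_{1,…,k} ^ n` of the last symbol is replaced by
  `(𝓑_k + 𝓗_{1,…,k-1}) ^ (n+1) / (n+1)`, the Bernoulli symbol `𝓑_k` (which occurs nowhere else,
  hence is independent of all the others) is evaluated, and the resulting polynomial in the
  remaining symbols is evaluated recursively. -/
def renormEval : (d : ℕ) → MvPolynomial (Fin (d + 1)) ℚ → ℚ
  | 0, p => ∑ m ∈ p.support, p.coeff m * (bernoulli (m 0 + 1) / ((m 0 : ℚ) + 1))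
  | d + 1, p => ∑ m ∈ p.support, p.coeff m *
      renormEval d
        ((∏ k : Fin (d + 1), MvPolynomial.X k ^ m k.castSucc) *
          bernoulliEval
            ((1 / ((m (Fin.last (d + 1)) : ℚ) + 1)) •
              (Polynomial.X + Polynomial.C (MvPolynomial.X (Fin.last d))) ^
                (m (Fin.last (d + 1)) + 1)))

/-- `H_{-n_1,…,-n_r}(∞) = ∏_{k=1}^r 𝓗_{1,…,k}^{n_k}(∞)` with `r = d + 1`. -/
def renormH (d : ℕ) (n : Fin (d + 1) → ℕ) : ℚ :=
  renormEval d (∏ k : Fin (d + 1), MvPolynomial.X k ^ n k)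

/-- For `r = d + 1` and indices `k_2, …, k_r` (`k i` standing for `k_{i+2}`), this is
`∑_{i=j}^r n_i + (r - j + 1) - ∑_{i=j+1}^r k_i`, where the argument `j` of the function
stands for `j + 1`. The subtraction is exact for all `k` that occur in `raabeZeta`. -/
def raabeIndex {d : ℕ} (n : Fin (d + 1) → ℕ) (k : Fin d → ℕ) (j : Fin (d + 1)) : ℕ :=
  (∑ i ∈ Finset.univ.filter (fun i => j ≤ i), n i) + (d + 1 - (j : ℕ))
    - ∑ i ∈ Finset.univ.filter (fun i : Fin d => j < i.succ), k i

/-- The tuples `(k_2, …, k_r)` of natural numbers such that each `k_j` is at most the upper entry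
of the binomial coefficient whose lower entry it is. (The outer box contains all of them.) -/
def raabeTuples {d : ℕ} (n : Fin (d + 1) → ℕ) : Finset (Fin d → ℕ) :=
  (Fintype.piFinset fun _ : Fin d => Finset.range ((∑ i, n i) + d + 2)).filter
    fun k => ∀ j : Fin d, k j ≤ raabeIndex n k j.succ

/-- Raabe's value of `ζ(-n_1, …, -n_r)`, `r = d + 1`, as an `(r-1)`-fold sum. -/
def raabeZeta {d : ℕ} (n : Fin (d + 1) → ℕ) : ℚ :=
  (-1) ^ (∑ i, n i) * ∑ k ∈ raabeTuples n,
    bernoulli (raabeIndex n k 0) / (raabeIndex n k 0 : ℚ) *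
      ∏ j : Fin d, ((raabeIndex n k j.succ).choose (k j) : ℚ) *
        (bernoulli (k j) / (raabeIndex n k j.succ : ℚ))

/-- The multiple zeta series
`ζ(s_1, …, s_r) = ∑_{0 < k_1 < ⋯ < k_r} k_1 ^ (-s_1) ⋯ k_r ^ (-s_r)`. -/
def multipleZeta (r : ℕ) (s : Fin r → ℂ) : ℂ :=
  ∑' k : {k : Fin r → ℕ // StrictMono k ∧ ∀ i, 0 < k i}, ∏ i, ((k.1 i : ℕ) : ℂ) ^ (-s i)

/-- `f`, looked at for `Re z` large only, has a meromorphic continuation to a half-plane that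
contains `z₀`, this continuation is holomorphic at `z₀`, and its value there is `v`. -/
def HasContinuationValue (f : ℂ → ℂ) (z₀ v : ℂ) : Prop :=
  ∃ (c b : ℝ) (g : ℂ → ℂ), c < z₀.re ∧ MeromorphicOn g {z | c < z.re} ∧
    (∀ z : ℂ, b < z.re → g z = f z) ∧ AnalyticAt ℂ g z₀ ∧ g z₀ = v

/-- `v` is the value at `z` of the continuation of `F` in one variable after the other:
`F(s_1, …, s_r)` is continued in `s_r` to `s_r = z_r`, for all `s_1, …, s_{r-1}` with large real
parts; the value at `z_r` is continued in `s_{r-1}` to `s_{r-1} = z_{r-1}`, and so on down to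
`s_1 = z_1`. -/
def HasIteratedContinuationValue :
    (r : ℕ) → ((Fin r → ℂ) → ℂ) → (Fin r → ℂ) → ℂ → Prop
  | 0, F, z, v => F z = v
  | r + 1, F, z, v => ∃ (A : ℝ) (G : (Fin r → ℂ) → ℂ),
      (∀ s : Fin r → ℂ, (∀ i, A < (s i).re) →
        HasContinuationValue (fun w => F (Fin.snoc (α := fun _ => ℂ) s w)) (z (Fin.last r)) (G s)) ∧
      HasIteratedContinuationValue r G (fun i => z i.castSucc) v

end

/-! All three quantities obey one recursion on the depth. The last entry $n_r$ is removed, $n_{r-1}$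
grows by $n_r+1-j$, and one sums over $0\le j\le n_r+1$ with weight $\binom{n_r+1}{j}B_j/(n_r+1)$.
Signs aside, depth one gives $B_{n+1}/(n+1)$.

For the symbols this is the binomial expansion of $(\mathcal B_r+\mathcal
H_{1,\dots,r-1})^{n_r+1}/(n_r+1)$ (`renormH_succ`); for Raabe's sum it is the summation over $k_r=j$
(`raabeSum_succ`).

For the zeta function, the innermost sum over $k_r>K=k_{r-1}$ is $\zeta(w)-\sum_{m\le K}m^{-w}$,
which continues to $w=-n_r$ (`hasContinuationValue_multipleZeta_snoc`). There Faulhaber's formula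
makes it a polynomial in $K$ (`riemannZeta_neg_nat_sub_sum_pow`). Each power of $K$ shifts the
exponent of $k_{r-1}$, leaving a finite combination of shifted zeta functions of depth $r-1$.
Uniqueness of the value is the identity theorem, applied one variable at a time. -/

/-! ### Depth recursion for the Bernoulli symbols -/

namespace MvPolynomial

/-- The sum over the support of a polynomial of its coefficients weighted by `φ`, as a linear
functional. -/
theorem exists_linearMap_eq_sum_support {σ : Type*} (φ : (σ →₀ ℕ) → ℚ) :
    ∃ L : MvPolynomial σ ℚ →ₗ[ℚ] ℚ, ∀ p, L p = ∑ m ∈ p.support, p.coeff m * φ m := by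
  refine ⟨(basisMonomials σ ℚ).constr ℚ φ, fun p => ?_⟩
  rw [Module.Basis.constr_apply]
  rfl

theorem prod_X_pow_eq_monomial_equivFunOnFinite {σ : Type*} [Fintype σ] (n : σ → ℕ) :
    (∏ k, X k ^ n k : MvPolynomial σ ℚ) = monomial (Finsupp.equivFunOnFinite.symm n) 1 := by
  rw [monomial_eq, Finsupp.prod_fintype _ _ (by simp)]
  simp

end MvPolynomial

/-- Linearity concerns only the outermost sum over monomials, so a case split suffices and no
induction is needed. -/
theorem exists_linearMap_eq_renormEval (d : ℕ) :
    ∃ L : MvPolynomial (Fin (d + 1)) ℚ →ₗ[ℚ] ℚ, ∀ p, L p = renormEval d p := by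
  cases d with
  | zero =>
    obtain ⟨L, hL⟩ := MvPolynomial.exists_linearMap_eq_sum_support
      (σ := Fin (0 + 1)) (fun m => bernoulli (m 0 + 1) / ((m 0 : ℚ) + 1))
    exact ⟨L, fun p => by rw [hL, renormEval]⟩
  | succ d =>
    obtain ⟨L, hL⟩ := MvPolynomial.exists_linearMap_eq_sum_support (σ := Fin (d + 1 + 1))
      (fun m => renormEval d
        ((∏ k : Fin (d + 1), MvPolynomial.X k ^ m k.castSucc) *
          bernoulliEval
            ((1 / ((m (Fin.last (d + 1)) : ℚ) + 1)) •
              (Polynomial.X + Polynomial.C (MvPolynomial.X (Fin.last d))) ^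
                (m (Fin.last (d + 1)) + 1))))
    exact ⟨L, fun p => by rw [hL, renormEval]⟩

theorem renormH_zero (n : Fin 1 → ℕ) :
    renormH 0 n = bernoulli (n 0 + 1) / ((n 0 : ℚ) + 1) := by
  classical
  rw [renormH, MvPolynomial.prod_X_pow_eq_monomial_equivFunOnFinite, renormEval,
    MvPolynomial.support_monomial, if_neg one_ne_zero]
  simp

theorem bernoulliEval_smul_X_add_C_pow {R : Type*} [CommRing R] [Algebra ℚ R] (c : ℚ) (a : R)
    (N : ℕ) :
    bernoulliEval (c • (Polynomial.X + Polynomial.C a) ^ N) =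
      ∑ j ∈ Finset.range (N + 1), (c * N.choose j * bernoulli j) • a ^ (N - j) := by
  rw [bernoulliEval]
  have hcoeff (j : ℕ) : (c • (Polynomial.X + Polynomial.C a) ^ N).coeff j =
      (c * N.choose j) • a ^ (N - j) := by
    rw [Polynomial.coeff_smul, Polynomial.coeff_X_add_C_pow, mul_smul, mul_comm,
      Nat.cast_smul_eq_nsmul, nsmul_eq_mul]
  -- The support can be smaller than the range, since powers of `a` may vanish.
  rw [Finset.sum_subset (s₂ := Finset.range (N + 1))]
  · refine Finset.sum_congr rfl fun j _ => ?_
    rw [hcoeff, smul_smul, mul_comm]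
  · intro j hj
    by_contra h
    rw [Polynomial.mem_support_iff, hcoeff, Nat.choose_eq_zero_of_lt (by simpa using h)] at hj
    simp at hj
  · intro j _ hj
    rw [Polynomial.notMem_support_iff.mp hj, smul_zero]

/-- Drop the last exponent and replace the last but one by its sum with `a`. -/
def mergeLast {d : ℕ} (n : Fin (d + 2) → ℕ) (a : ℕ) : Fin (d + 1) → ℕ :=
  fun i => n i.castSucc + if i = Fin.last d then a else 0

theorem prod_X_pow_mergeLast {d : ℕ} (n : Fin (d + 2) → ℕ) (a : ℕ) :
    (∏ k : Fin (d + 1), MvPolynomial.X k ^ mergeLast n a k : MvPolynomial (Fin (d + 1)) ℚ) =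
      (∏ k : Fin (d + 1), MvPolynomial.X k ^ n k.castSucc) *
        MvPolynomial.X (Fin.last d) ^ a := by
  simp only [mergeLast, pow_add, Finset.prod_mul_distrib, pow_ite, pow_zero,
    Finset.prod_ite_eq', Finset.mem_univ, if_true]

theorem renormH_succ (d : ℕ) (n : Fin (d + 2) → ℕ) :
    renormH (d + 1) n = ∑ j ∈ Finset.range (n (Fin.last (d + 1)) + 2),
      ((n (Fin.last (d + 1)) + 1).choose j : ℚ) *
        (bernoulli j / ((n (Fin.last (d + 1)) + 1 : ℕ) : ℚ)) *
        renormH d (mergeLast n (n (Fin.last (d + 1)) + 1 - j)) := by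
  classical
  obtain ⟨L, hL⟩ := exists_linearMap_eq_renormEval d
  rw [renormH, MvPolynomial.prod_X_pow_eq_monomial_equivFunOnFinite, renormEval,
    MvPolynomial.support_monomial, if_neg one_ne_zero, Finset.sum_singleton]
  simp only [MvPolynomial.coeff_monomial, if_true, one_mul, Finsupp.equivFunOnFinite_symm_apply_apply]
  rw [bernoulliEval_smul_X_add_C_pow, Finset.mul_sum, ← hL, map_sum]
  refine Finset.sum_congr rfl fun j _ => ?_
  rw [mul_smul_comm, map_smul, renormH, prod_X_pow_mergeLast, hL, smul_eq_mul]
  push_cast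
  ring

/-! ### Depth recursion for Raabe's sum -/

/-- The sum in Raabe's value, without the sign. -/
def raabeSum {d : ℕ} (n : Fin (d + 1) → ℕ) : ℚ :=
  ∑ k ∈ raabeTuples n,
    bernoulli (raabeIndex n k 0) / (raabeIndex n k 0 : ℚ) *
      ∏ j : Fin d, ((raabeIndex n k j.succ).choose (k j) : ℚ) *
        (bernoulli (k j) / (raabeIndex n k j.succ : ℚ))

theorem raabeIndex_le {d : ℕ} (n : Fin (d + 1) → ℕ) (k : Fin d → ℕ) (j : Fin (d + 1)) :
    raabeIndex n k j ≤ ∑ i, n i + d + 1 := by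
  have : ∑ i ∈ Finset.univ.filter (fun i => j ≤ i), n i ≤ ∑ i, n i :=
    Finset.sum_le_sum_of_subset (Finset.filter_subset _ _)
  unfold raabeIndex
  omega

theorem mem_raabeTuples {d : ℕ} {n : Fin (d + 1) → ℕ} {k : Fin d → ℕ} :
    k ∈ raabeTuples n ↔ ∀ j : Fin d, k j ≤ raabeIndex n k j.succ := by
  simp only [raabeTuples, Finset.mem_filter, Fintype.mem_piFinset, Finset.mem_range,
    and_iff_right_iff_imp]
  intro h j
  have := (h j).trans (raabeIndex_le n k j.succ)
  omega

theorem raabeIndex_last {d : ℕ} (n : Fin (d + 1) → ℕ) (k : Fin d → ℕ) :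
    raabeIndex n k (Fin.last d) = n (Fin.last d) + 1 := by
  have h1 : Finset.univ.filter (fun i => Fin.last d ≤ i) = {Fin.last d} := by
    ext i; simp [Fin.last_le_iff]
  have h2 : Finset.univ.filter (fun i : Fin d => Fin.last d < i.succ) = ∅ := by
    ext i; simp [Fin.le_last]
  rw [raabeIndex, h1, h2]
  simp

/-- Every $N_j$ with $j<r$ contains the full contribution $n_r+1-k_r$ of the last place, so it may
be booked under $n_{r-1}$ instead. The bound `ha` makes the truncated subtraction exact. -/
theorem raabeIndex_snoc_castSucc {d : ℕ} (n : Fin (d + 2) → ℕ) (k : Fin d → ℕ) (a : ℕ)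
    (ha : a ≤ n (Fin.last (d + 1)) + 1) (j : Fin (d + 1)) :
    raabeIndex n (Fin.snoc (α := fun _ => ℕ) k a) j.castSucc =
      raabeIndex (mergeLast n (n (Fin.last (d + 1)) + 1 - a)) k j := by
  have hj := j.is_lt
  have hlast : j.castSucc < Fin.last (d + 1) := Fin.castSucc_lt_last j
  simp only [raabeIndex, mergeLast, Finset.sum_filter, Fin.sum_univ_castSucc (n := d + 1),
    Fin.sum_univ_castSucc (n := d) (f := fun i => if j.castSucc < i.succ then
      (Fin.snoc (α := fun _ => ℕ) k a : Fin (d + 1) → ℕ) i else 0), Fin.snoc_castSucc,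
    Fin.snoc_last, Fin.succ_last, Fin.castSucc_le_castSucc_iff, Fin.succ_castSucc,
    Fin.castSucc_lt_castSucc_iff, if_pos hlast, if_pos hlast.le, Fin.val_castSucc]
  have : ∑ i : Fin (d + 1), (if j ≤ i then n i.castSucc +
      (if i = Fin.last d then n (Fin.last (d + 1)) + 1 - a else 0) else 0) =
      ∑ i : Fin (d + 1), (if j ≤ i then n i.castSucc else 0) +
        (n (Fin.last (d + 1)) + 1 - a) := by
    rw [Finset.sum_congr rfl (g := fun i : Fin (d + 1) => (if j ≤ i then n i.castSucc else 0) +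
      (if i = Fin.last d then n (Fin.last (d + 1)) + 1 - a else 0)), Finset.sum_add_distrib]
    · simp
    · intro i _
      by_cases h : j ≤ i
      · simp [h]
      · have : i ≠ Fin.last d := fun h' => h (h' ▸ Fin.le_last j)
        simp [h, this]
  rw [this]
  omega

theorem snoc_mem_raabeTuples {d : ℕ} {n : Fin (d + 2) → ℕ} {k : Fin d → ℕ} {a : ℕ} :
    (Fin.snoc (α := fun _ => ℕ) k a : Fin (d + 1) → ℕ) ∈ raabeTuples n ↔
      a ≤ n (Fin.last (d + 1)) + 1 ∧
        k ∈ raabeTuples (mergeLast n (n (Fin.last (d + 1)) + 1 - a)) := by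
  rw [mem_raabeTuples, Fin.forall_fin_succ', and_comm, Fin.succ_last, raabeIndex_last,
    Fin.snoc_last]
  refine and_congr_right fun ha => ?_
  rw [mem_raabeTuples]
  refine forall_congr' fun j => ?_
  rw [Fin.snoc_castSucc, Fin.succ_castSucc, raabeIndex_snoc_castSucc n k a ha]

/-- The upper entry $N_r=n_r+1$ does not depend on the tuple, so the factor of $k_r$ splits off and
the other factors form a Raabe sum for the merged exponents. -/
theorem raabeSum_succ {d : ℕ} (n : Fin (d + 2) → ℕ) :
    raabeSum n = ∑ j ∈ Finset.range (n (Fin.last (d + 1)) + 2),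
      ((n (Fin.last (d + 1)) + 1).choose j : ℚ) *
        (bernoulli j / ((n (Fin.last (d + 1)) + 1 : ℕ) : ℚ)) *
        raabeSum (mergeLast n (n (Fin.last (d + 1)) + 1 - j)) := by
  simp only [raabeSum, Finset.mul_sum]
  rw [Finset.sum_sigma']
  refine Finset.sum_bij' (fun k _ => ⟨k (Fin.last d), fun i => k i.castSucc⟩)
    (fun x _ => Fin.snoc (α := fun _ => ℕ) x.2 x.1) ?_ ?_ ?_ ?_ ?_
  · intro k hk
    rw [← Fin.snoc_init_self k] at hk
    obtain ⟨h1, h2⟩ := snoc_mem_raabeTuples.mp hk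
    exact Finset.mem_sigma.mpr ⟨Finset.mem_range.mpr (Nat.lt_succ_of_le h1), h2⟩
  · rintro ⟨a, k⟩ h
    obtain ⟨h1, h2⟩ := Finset.mem_sigma.mp h
    exact snoc_mem_raabeTuples.mpr ⟨by have := Finset.mem_range.mp h1; omega, h2⟩
  · intro k _
    exact Fin.snoc_init_self k
  · rintro ⟨a, k⟩ _
    simp
  · intro k hk
    obtain ⟨k, a, rfl⟩ : ∃ (k' : Fin d → ℕ) (a : ℕ), k = Fin.snoc (α := fun _ => ℕ) k' a :=
      ⟨_, _, (Fin.snoc_init_self k).symm⟩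
    obtain ⟨ha, -⟩ := snoc_mem_raabeTuples.mp hk
    simp only [Fin.snoc_castSucc, Fin.snoc_last]
    rw [Fin.prod_univ_castSucc]
    simp only [Fin.snoc_castSucc, Fin.snoc_last, Fin.succ_last, raabeIndex_last, Fin.succ_castSucc,
      raabeIndex_snoc_castSucc n k a ha]
    rw [← Fin.castSucc_zero, raabeIndex_snoc_castSucc n k a ha]
    ring

theorem raabeSum_zero (n : Fin 1 → ℕ) :
    raabeSum n = bernoulli (n 0 + 1) / ((n 0 : ℚ) + 1) := by
  have h (k : Fin 0 → ℕ) : raabeIndex n k 0 = n 0 + 1 := raabeIndex_last n k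
  have : raabeTuples n = Finset.univ := by
    ext k
    simp only [mem_raabeTuples, Finset.mem_univ, iff_true]
    exact fun j => j.elim0
  simp [raabeSum, this, h]

theorem renormH_eq_raabeSum (d : ℕ) (n : Fin (d + 1) → ℕ) : renormH d n = raabeSum n := by
  induction d with
  | zero => rw [renormH_zero, raabeSum_zero]
  | succ d ih => simp only [renormH_succ, raabeSum_succ, ih]

/-! ### Uniqueness, linearity and translation of continued values -/

namespace HasContinuationValue

theorem congr {f f' : ℂ → ℂ} {z v : ℂ} {B : ℝ} (h : HasContinuationValue f z v)
    (hf : ∀ w : ℂ, B < w.re → f w = f' w) : HasContinuationValue f' z v := by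
  obtain ⟨c, b, g, hc, hg, hgf, ha, hv⟩ := h
  refine ⟨c, max b B, g, hc, hg, fun w hw => ?_, ha, hv⟩
  rw [hgf w ((le_max_left _ _).trans_lt hw), hf w ((le_max_right _ _).trans_lt hw)]

/-- Identity theorem on the common half-plane, which is connected: the difference of two
continuations has order `⊤` far to the right, hence everywhere. -/
theorem unique {f : ℂ → ℂ} {z v v' : ℂ} (h : HasContinuationValue f z v)
    (h' : HasContinuationValue f z v') : v = v' := by
  obtain ⟨c, b, g, hc, hg, hgf, ha, rfl⟩ := h
  obtain ⟨c', b', g', hc', hg', hgf', ha', rfl⟩ := h'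
  set U : Set ℂ := {w | max c c' < w.re}
  have hsub : MeromorphicOn (g - g') U :=
    (hg.mono_set fun w hw => (le_max_left c c').trans_lt hw).sub
      (hg'.mono_set fun w hw => (le_max_right c c').trans_lt hw)
  have hU : IsPreconnected U := (convex_halfSpace_re_gt _).isPreconnected
  set B : ℝ := max (max b b') (max c c')
  have hx : ((B + 1 : ℝ) : ℂ) ∈ {w : ℂ | B < w.re} := by simp
  have hxU : ((B + 1 : ℝ) : ℂ) ∈ U := (le_max_right (max b b') (max c c')).trans_lt hx
  have htop : meromorphicOrderAt (g - g') ((B + 1 : ℝ) : ℂ) = ⊤ := by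
    rw [meromorphicOrderAt_eq_top_iff]
    refine Filter.Eventually.filter_mono nhdsWithin_le_nhds ?_
    filter_upwards [(isOpen_lt continuous_const Complex.continuous_re).mem_nhds hx] with w hw
    have hw' : max b b' < w.re := (le_max_left _ _).trans_lt hw
    rw [Pi.sub_apply, hgf w ((le_max_left _ _).trans_lt hw'),
      hgf' w ((le_max_right _ _).trans_lt hw'), sub_self]
  have hz : meromorphicOrderAt (g - g') z = ⊤ := by
    by_contra hne
    exact hsub.meromorphicOrderAt_ne_top_of_isPreconnected hU (max_lt hc hc') hxU hne htop
  rw [meromorphicOrderAt_eq_top_iff] at hz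
  -- Order `⊤` only gives vanishing on a punctured neighbourhood; analyticity carries it to `z`
  -- itself.
  have han : AnalyticAt ℂ (g - g') z := ha.sub ha'
  have := (han.frequently_zero_iff_eventually_zero.mp hz.frequently).self_of_nhds
  exact sub_eq_zero.mp this

theorem zero (z : ℂ) : HasContinuationValue (fun _ => 0) z 0 :=
  ⟨z.re - 1, 0, fun _ => 0, by simp, .const 0, fun _ _ => rfl, analyticAt_const, rfl⟩

theorem add {f f' : ℂ → ℂ} {z v v' : ℂ} (h : HasContinuationValue f z v)
    (h' : HasContinuationValue f' z v') :
    HasContinuationValue (fun w => f w + f' w) z (v + v') := by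
  obtain ⟨c, b, g, hc, hg, hgf, ha, rfl⟩ := h
  obtain ⟨c', b', g', hc', hg', hgf', ha', rfl⟩ := h'
  refine ⟨max c c', max b b', g + g', max_lt hc hc',
    (hg.mono_set fun w hw => (le_max_left c c').trans_lt hw).add
      (hg'.mono_set fun w hw => (le_max_right c c').trans_lt hw), fun w hw => ?_, ha.add ha', rfl⟩
  rw [Pi.add_apply, hgf w ((le_max_left _ _).trans_lt hw), hgf' w ((le_max_right _ _).trans_lt hw)]

theorem const_mul {f : ℂ → ℂ} {z v : ℂ} (a : ℂ) (h : HasContinuationValue f z v) :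
    HasContinuationValue (fun w => a * f w) z (a * v) := by
  obtain ⟨c, b, g, hc, hg, hgf, ha, rfl⟩ := h
  exact ⟨c, b, fun w => a * g w, hc, fun w hw => (MeromorphicAt.const a w).mul (hg w hw),
    fun w hw => congrArg (a * ·) (hgf w hw), analyticAt_const.mul ha, rfl⟩

theorem comp_sub {f : ℂ → ℂ} {z v : ℂ} (a : ℂ) (h : HasContinuationValue f (z - a) v) :
    HasContinuationValue (fun w => f (w - a)) z v := by
  obtain ⟨c, b, g, hc, hg, hgf, ha, rfl⟩ := h
  have hsub (w : ℂ) : AnalyticAt ℂ (fun w : ℂ => w - a) w := analyticAt_id.sub analyticAt_const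
  refine ⟨c + a.re, b + a.re, fun w => g (w - a), ?_, fun w hw => ?_, fun w hw => ?_,
    AnalyticAt.fun_comp (f := fun w => w - a) ha (hsub z), rfl⟩
  · rw [Complex.sub_re] at hc
    linarith
  · refine MeromorphicAt.comp_analyticAt (g := fun w => w - a) (hg (w - a) ?_) (hsub w)
    have : c + a.re < w.re := hw
    simp only [Set.mem_ofPred_eq, Complex.sub_re]
    linarith
  · refine hgf (w - a) ?_
    rw [Complex.sub_re]
    linarith

end HasContinuationValue

namespace HasIteratedContinuationValue

theorem congr {r : ℕ} {F F' : (Fin r → ℂ) → ℂ} {z : Fin r → ℂ} {v : ℂ} {B : ℝ}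
    (h : HasIteratedContinuationValue r F z v)
    (hF : ∀ s : Fin r → ℂ, (∀ i, B < (s i).re) → F s = F' s) :
    HasIteratedContinuationValue r F' z v := by
  cases r with
  | zero =>
    rw [HasIteratedContinuationValue] at h ⊢
    rw [← hF z fun i => i.elim0, h]
  | succ r =>
    obtain ⟨A, G, hG, hv⟩ := h
    refine ⟨max A B, G, fun s hs => ?_, hv⟩
    refine (hG s fun i => (le_max_left _ _).trans_lt (hs i)).congr (B := B) fun w hw => ?_
    refine hF _ fun i => ?_
    induction i using Fin.lastCases with
    | last => simpa using hw
    | cast i => simpa using (le_max_right _ _).trans_lt (hs i)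

theorem unique {r : ℕ} {F : (Fin r → ℂ) → ℂ} {z : Fin r → ℂ} {v v' : ℂ}
    (h : HasIteratedContinuationValue r F z v) (h' : HasIteratedContinuationValue r F z v') :
    v = v' := by
  induction r with
  | zero =>
    rw [HasIteratedContinuationValue] at h h'
    exact h.symm.trans h'
  | succ r ih =>
    obtain ⟨A, G, hG, hv⟩ := h
    obtain ⟨A', G', hG', hv'⟩ := h'
    refine ih (hv.congr (B := max A A') fun s hs => ?_) hv'
    exact (hG s fun i => (le_max_left _ _).trans_lt (hs i)).unique
      (hG' s fun i => (le_max_right _ _).trans_lt (hs i))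

theorem zero (r : ℕ) (z : Fin r → ℂ) : HasIteratedContinuationValue r (fun _ => 0) z 0 := by
  induction r with
  | zero => rfl
  | succ r ih => exact ⟨0, fun _ => 0, fun _ _ => .zero _, ih _⟩

theorem add {r : ℕ} {F F' : (Fin r → ℂ) → ℂ} {z : Fin r → ℂ} {v v' : ℂ}
    (h : HasIteratedContinuationValue r F z v) (h' : HasIteratedContinuationValue r F' z v') :
    HasIteratedContinuationValue r (fun s => F s + F' s) z (v + v') := by
  induction r generalizing v v' with
  | zero =>
    rw [HasIteratedContinuationValue] at h h' ⊢
    rw [h, h']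
  | succ r ih =>
    obtain ⟨A, G, hG, hv⟩ := h
    obtain ⟨A', G', hG', hv'⟩ := h'
    exact ⟨max A A', fun s => G s + G' s, fun s hs =>
      (hG s fun i => (le_max_left _ _).trans_lt (hs i)).add
        (hG' s fun i => (le_max_right _ _).trans_lt (hs i)), ih hv hv'⟩

theorem const_mul {r : ℕ} {F : (Fin r → ℂ) → ℂ} {z : Fin r → ℂ} {v : ℂ} (a : ℂ)
    (h : HasIteratedContinuationValue r F z v) :
    HasIteratedContinuationValue r (fun s => a * F s) z (a * v) := by
  induction r generalizing v with
  | zero =>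
    rw [HasIteratedContinuationValue] at h ⊢
    rw [h]
  | succ r ih =>
    obtain ⟨A, G, hG, hv⟩ := h
    exact ⟨A, fun s => a * G s, fun s hs => (hG s hs).const_mul a, ih hv⟩

theorem sum {ι : Type*} (S : Finset ι) {r : ℕ} {F : ι → (Fin r → ℂ) → ℂ} {z : Fin r → ℂ}
    {v : ι → ℂ} (h : ∀ j ∈ S, HasIteratedContinuationValue r (F j) z (v j)) :
    HasIteratedContinuationValue r (fun s => ∑ j ∈ S, F j s) z (∑ j ∈ S, v j) := by
  classical
  induction S using Finset.induction_on with
  | empty => simpa using zero r z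
  | insert j S hj ih =>
    simp only [Finset.sum_insert hj]
    exact (h j (Finset.mem_insert_self j S)).add
      (ih fun i hi => h i (Finset.mem_insert_of_mem hi))

theorem comp_sub_last {r : ℕ} {F : (Fin (r + 1) → ℂ) → ℂ} {z : Fin (r + 1) → ℂ} {v : ℂ} (a : ℂ)
    (h : HasIteratedContinuationValue (r + 1) F (fun i => z i - if i = Fin.last r then a else 0) v) :
    HasIteratedContinuationValue (r + 1)
      (fun s => F fun i => s i - if i = Fin.last r then a else 0) z v := by
  obtain ⟨A, G, hG, hv⟩ := h
  refine ⟨A, G, fun s hs => ?_, by simpa [(Fin.castSucc_lt_last _).ne] using hv⟩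
  have h := hG s hs
  simp only [if_true] at h
  convert h.comp_sub a using 4 with w i
  induction i using Fin.lastCases with
  | last => simp
  | cast i => simp [(Fin.castSucc_lt_last i).ne]

end HasIteratedContinuationValue

/-! ### Regularity of the Riemann zeta function -/

theorem analyticAt_riemannZeta {s : ℂ} (hs : s ≠ 1) : AnalyticAt ℂ riemannZeta s :=
  DifferentiableOn.analyticAt (s := {1}ᶜ)
    (fun _ hw => (differentiableAt_riemannZeta hw).differentiableWithinAt)
    (isOpen_compl_singleton.mem_nhds hs)

theorem neg_natCast_ne_one (n : ℕ) : (-(n : ℂ)) ≠ 1 := by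
  intro h
  have hre := congrArg Complex.re h
  have hn : (0 : ℝ) ≤ n := n.cast_nonneg
  simp only [Complex.neg_re, Complex.natCast_re, Complex.one_re] at hre
  linarith

theorem meromorphicAt_riemannZeta (s : ℂ) : MeromorphicAt riemannZeta s := by
  rcases eq_or_ne s 1 with rfl | hs
  -- At the pole, $(s-1)\zeta(s)$ has a removable singularity with value 1; dividing by $s-1$
  -- recovers $\zeta$.
  · have hcont : ContinuousAt (Function.update (fun s : ℂ => (s - 1) * riemannZeta s) 1 1) 1 :=
      continuousAt_update_same.mpr riemannZeta_residue_one
    have hmero := (Complex.analyticAt_of_differentiable_on_punctured_nhds_of_continuousAt ?_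
      hcont).meromorphicAt
    · refine (hmero.div ((MeromorphicAt.id (1 : ℂ)).sub (.const 1 1))).congr ?_
      filter_upwards [self_mem_nhdsWithin] with w hw
      have : w - 1 ≠ 0 := sub_ne_zero.mpr hw
      simp [Function.update_of_ne (show w ≠ 1 from hw), this]
    · filter_upwards [self_mem_nhdsWithin] with w hw
      have h1 : DifferentiableAt ℂ (fun s : ℂ => (s - 1) * riemannZeta s) w :=
        (differentiableAt_id.sub_const 1).mul (differentiableAt_riemannZeta hw)
      refine h1.congr_of_eventuallyEq ?_
      filter_upwards [isOpen_compl_singleton.mem_nhds hw] with u hu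
      exact Function.update_of_ne hu _ _
  · exact (analyticAt_riemannZeta hs).meromorphicAt

/-! ### Absolute convergence of the multiple zeta series -/

theorem Summable.prod_fin_apply {f : ℕ → ℝ} (hf : Summable f) (h0 : ∀ n, 0 ≤ f n) (r : ℕ) :
    Summable fun k : Fin r → ℕ => ∏ i, f (k i) := by
  induction r with
  | zero => exact (hasSum_fintype _).summable
  | succ r ih =>
    rw [← (Fin.consEquiv fun _ => ℕ).summable_iff]
    refine (hf.mul_of_nonneg ih h0 fun k => Finset.prod_nonneg fun i _ => h0 _).congr fun x => ?_
    simp [Fin.consEquiv, Fin.prod_univ_succ]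

/-- The index set of the multiple zeta series. -/
abbrev StrictMonoPosTuple (r : ℕ) : Type := {k : Fin r → ℕ // StrictMono k ∧ ∀ i, 0 < k i}

/-- A term of the multiple zeta series. -/
noncomputable def multipleZetaTerm {r : ℕ} (s : Fin r → ℂ) (k : Fin r → ℕ) : ℂ := ∏ i, (k i : ℂ) ^ (-s i)

theorem norm_multipleZetaTerm {r : ℕ} (s : Fin r → ℂ) {k : Fin r → ℕ} (hk : ∀ i, 0 < k i) :
    ‖multipleZetaTerm s k‖ = ∏ i, (k i : ℝ) ^ (-(s i).re) := by
  rw [multipleZetaTerm, norm_prod]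
  refine Finset.prod_congr rfl fun i _ => ?_
  rw [Complex.norm_natCast_cpow_of_pos (hk i), Complex.neg_re]

/-- A majorant independent of `s`, summable even without the ordering of the indices. The spare
factor $k_r^p$ leaves room for the growth of the continued inner sum. -/
theorem norm_multipleZetaTerm_mul_pow_le {r : ℕ} {s : Fin (r + 1) → ℂ} {p : ℕ}
    (hs : ∀ i, (p : ℝ) + 2 ≤ (s i).re) {k : Fin (r + 1) → ℕ} (hk : ∀ i, 0 < k i) :
    ‖multipleZetaTerm s k‖ * (k (Fin.last r) : ℝ) ^ p ≤ ∏ i, ((k i : ℝ) ^ 2)⁻¹ := by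
  have hk1 (i : Fin (r + 1)) : (1 : ℝ) ≤ k i := by exact_mod_cast hk i
  have hle (q : ℕ) (x : ℝ) (i : Fin (r + 1)) (h : (q : ℝ) + 2 ≤ x) :
      (k i : ℝ) ^ (-x) * (k i : ℝ) ^ q ≤ ((k i : ℝ) ^ 2)⁻¹ := by
    have h0 : (0 : ℝ) < k i := one_pos.trans_le (hk1 i)
    rw [← Real.rpow_natCast, ← Real.rpow_add h0, ← Real.rpow_natCast, ← Real.rpow_neg h0.le]
    refine Real.rpow_le_rpow_of_exponent_le (hk1 i) ?_
    push_cast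
    linarith
  rw [norm_multipleZetaTerm s hk, Fin.prod_univ_castSucc, Fin.prod_univ_castSucc, mul_assoc]
  refine mul_le_mul (Finset.prod_le_prod (fun i _ => by positivity) fun i _ => ?_)
    (hle p _ _ (hs _)) (by positivity) (Finset.prod_nonneg fun i _ => by positivity)
  have hp : (0 : ℝ) ≤ p := p.cast_nonneg
  simpa using hle 0 (s i.castSucc).re i.castSucc (by push_cast; linarith [hs i.castSucc])

theorem summable_prod_inv_sq (r : ℕ) :
    Summable fun k : StrictMonoPosTuple r => ∏ i, ((k.1 i : ℝ) ^ 2)⁻¹ :=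
  (Summable.prod_fin_apply (Real.summable_nat_pow_inv.mpr one_lt_two)
    (fun n => by positivity) r).comp_injective Subtype.val_injective

theorem summable_multipleZetaTerm_mul {r : ℕ} {s : Fin (r + 1) → ℂ} {p : ℕ}
    (hs : ∀ i, (p : ℝ) + 2 ≤ (s i).re) {f : StrictMonoPosTuple (r + 1) → ℂ}
    (hf : ∀ k, ‖f k‖ ≤ (k.1 (Fin.last r) : ℝ) ^ p) :
    Summable fun k : StrictMonoPosTuple (r + 1) => multipleZetaTerm s k.1 * f k := by
  refine Summable.of_norm_bounded (summable_prod_inv_sq (r + 1)) fun k => ?_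
  rw [norm_mul]
  exact (mul_le_mul_of_nonneg_left (hf k) (norm_nonneg _)).trans
    (norm_multipleZetaTerm_mul_pow_le hs k.2.2)

theorem summable_multipleZetaTerm {r : ℕ} {s : Fin (r + 1) → ℂ} (hs : ∀ i, 2 ≤ (s i).re) :
    Summable fun k : StrictMonoPosTuple (r + 1) => multipleZetaTerm s k.1 := by
  simpa using summable_multipleZetaTerm_mul (p := 0) (f := fun _ => 1) (by simpa using hs)
    (by simp)

/-! ### Continuation in the last variable -/

/-- A strictly increasing tuple is a shorter one together with a larger last entry. -/
def strictMonoPosTupleSnocEquiv (r : ℕ) :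
    (Σ k : StrictMonoPosTuple (r + 1), {m : ℕ | k.1 (Fin.last r) < m}) ≃
      StrictMonoPosTuple (r + 2) where
  toFun x := ⟨Fin.snoc (α := fun _ => ℕ) x.1.1 x.2.1, by
    constructor
    · refine Fin.strictMono_iff_lt_succ.mpr fun i => ?_
      induction i using Fin.lastCases with
      | last =>
        rw [Fin.succ_last, Fin.snoc_last, Fin.snoc_castSucc]
        exact x.2.2
      | cast i =>
        rw [Fin.succ_castSucc, Fin.snoc_castSucc, Fin.snoc_castSucc]
        exact x.1.2.1 Fin.castSucc_lt_succ
    · intro i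
      induction i using Fin.lastCases with
      | last =>
        rw [Fin.snoc_last]
        exact Nat.zero_lt_of_lt x.2.2
      | cast i => simpa using x.1.2.2 i⟩
  invFun k := ⟨⟨fun i => k.1 i.castSucc, fun i j h => k.2.1 (Fin.castSucc_lt_castSucc_iff.mpr h),
    fun i => k.2.2 _⟩, ⟨k.1 (Fin.last (r + 1)), k.2.1 (Fin.castSucc_lt_last _)⟩⟩
  left_inv := by
    rintro ⟨⟨k, hk⟩, ⟨m, hm⟩⟩
    refine Sigma.subtype_ext (Subtype.ext ?_) ?_ <;> simp
  right_inv k := Subtype.ext (Fin.snoc_init_self k.1)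

theorem tsum_lt_natCast_cpow {w : ℂ} (hw : 1 < w.re) (K : ℕ) :
    ∑' m : {m : ℕ | K < m}, ((m : ℕ) : ℂ) ^ (-w) =
      riemannZeta w - ∑ m ∈ Finset.Ico 1 (K + 1), (m : ℂ) ^ (-w) := by
  -- This makes the term $0^{-w}$ at $m=0$ vanish.
  have hw0 : w ≠ 0 := by
    rintro rfl
    norm_num at hw
  have hsum : Summable fun m : ℕ => (m : ℂ) ^ (-w) := by
    simpa [Complex.cpow_neg] using Complex.summable_one_div_nat_cpow.mpr hw
  have hset : {m : ℕ | K < m} = ((Finset.range (K + 1) : Finset ℕ) : Set ℕ)ᶜ := by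
    ext m
    simp
  have h := hsum.sum_add_tsum_compl (s := Finset.range (K + 1))
  rw [← hset, Finset.range_eq_Ico, Finset.sum_eq_sum_Ico_succ_bot (by omega)] at h
  rw [zeta_eq_tsum_one_div_nat_cpow hw, eq_sub_iff_add_eq', ← tsum_congr fun m : ℕ =>
    (Complex.cpow_neg (m : ℂ) w).trans (one_div _).symm, ← h]
  simp [hw0]

theorem multipleZeta_snoc {r : ℕ} {s : Fin (r + 1) → ℂ} (hs : ∀ i, 2 ≤ (s i).re) {w : ℂ}
    (hw : 2 ≤ w.re) :
    multipleZeta (r + 2) (Fin.snoc (α := fun _ => ℂ) s w) =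
      ∑' k : StrictMonoPosTuple (r + 1), multipleZetaTerm s k.1 *
        (riemannZeta w - ∑ m ∈ Finset.Ico 1 (k.1 (Fin.last r) + 1), (m : ℂ) ^ (-w)) := by
  have hsum : Summable fun k : StrictMonoPosTuple (r + 2) =>
      multipleZetaTerm (Fin.snoc (α := fun _ => ℂ) s w) k.1 := by
    refine summable_multipleZetaTerm fun i => ?_
    induction i using Fin.lastCases with
    | last => simpa using hw
    | cast i => simpa using hs i
  change ∑' k : StrictMonoPosTuple (r + 2), multipleZetaTerm _ k.1 = _
  rw [← (strictMonoPosTupleSnocEquiv r).tsum_eq]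
  refine (Summable.tsum_sigma ((strictMonoPosTupleSnocEquiv r).summable_iff.mpr hsum)).trans ?_
  refine tsum_congr fun k => ?_
  rw [← tsum_lt_natCast_cpow (by linarith), ← tsum_mul_left]
  refine tsum_congr fun m => ?_
  simp [multipleZetaTerm, strictMonoPosTupleSnocEquiv, Fin.prod_univ_castSucc]

theorem norm_sum_Ico_natCast_cpow_le {w : ℂ} {p : ℕ} (hw : -(p : ℝ) ≤ w.re) (K : ℕ) :
    ‖∑ m ∈ Finset.Ico 1 (K + 1), (m : ℂ) ^ (-w)‖ ≤ (K : ℝ) ^ (p + 1) := by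
  have h (m : ℕ) (hm : m ∈ Finset.Ico 1 (K + 1)) : ‖(m : ℂ) ^ (-w)‖ ≤ (K : ℝ) ^ p := by
    obtain ⟨h1, h2⟩ := Finset.mem_Ico.mp hm
    have h1' : (1 : ℝ) ≤ m := by exact_mod_cast h1
    have h2' : (m : ℝ) ≤ K := by exact_mod_cast Nat.le_of_lt_succ h2
    rw [Complex.norm_natCast_cpow_of_pos h1, Complex.neg_re]
    calc (m : ℝ) ^ (-w.re) ≤ (m : ℝ) ^ (p : ℝ) :=
          Real.rpow_le_rpow_of_exponent_le h1' (by linarith)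
      _ = (m : ℝ) ^ p := Real.rpow_natCast _ _
      _ ≤ (K : ℝ) ^ p := by gcongr
  refine (norm_sum_le_of_le _ h).trans_eq ?_
  rw [Finset.sum_const, Nat.card_Ico, Nat.add_sub_cancel, nsmul_eq_mul, pow_succ']

/-- The inner sum is $\zeta(w)$ minus an entire Dirichlet polynomial. For
$\operatorname{Re}w>-(n+1)$ the latter is at most $K^{n+2}$ in norm, so the series over the outer
indices converges normally once their exponents have real part at least $(n+2)+2$. -/
theorem hasContinuationValue_multipleZeta_snoc {r : ℕ} {s : Fin (r + 1) → ℂ} (n : ℕ)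
    (hs : ∀ i, (n : ℝ) + 4 ≤ (s i).re) :
    HasContinuationValue (fun w => multipleZeta (r + 2) (Fin.snoc (α := fun _ => ℂ) s w)) (-n)
      (∑' k : StrictMonoPosTuple (r + 1), multipleZetaTerm s k.1 *
        (riemannZeta (-n) - ∑ m ∈ Finset.Ico 1 (k.1 (Fin.last r) + 1), (m : ℂ) ^ n)) := by
  have hn : (0 : ℝ) ≤ n := n.cast_nonneg
  have hs2 (i : Fin (r + 1)) : 2 ≤ (s i).re := by linarith [hs i]
  have hs' (i : Fin (r + 1)) : ((n + 2 : ℕ) : ℝ) + 2 ≤ (s i).re := by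
    push_cast
    linarith [hs i]
  set P : StrictMonoPosTuple (r + 1) → ℂ → ℂ := fun k w =>
    ∑ m ∈ Finset.Ico 1 (k.1 (Fin.last r) + 1), (m : ℂ) ^ (-w) with hP
  set U : Set ℂ := {w | -((n : ℝ) + 1) < w.re} with hU
  have hUo : IsOpen U := isOpen_lt continuous_const Complex.continuous_re
  have hPle (w : ℂ) (hw : w ∈ U) (k : StrictMonoPosTuple (r + 1)) :
      ‖P k w‖ ≤ (k.1 (Fin.last r) : ℝ) ^ (n + 2) :=
    norm_sum_Ico_natCast_cpow_le (p := n + 1) (by push_cast; exact le_of_lt hw) _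
  have hdiff : DifferentiableOn ℂ (fun w => ∑' k, multipleZetaTerm s k.1 * P k w) U := by
    refine Complex.differentiableOn_tsum_of_summable_norm (summable_prod_inv_sq (r + 1))
      (fun k => ?_) hUo fun k w hw => ?_
    · refine Differentiable.differentiableOn ((differentiable_const _).mul ?_)
      refine Differentiable.fun_sum fun m hm => ?_
      have : (m : ℂ) ≠ 0 := Nat.cast_ne_zero.mpr (by have := (Finset.mem_Ico.mp hm).1; omega)
      exact differentiable_neg.const_cpow (Or.inl this)
    · rw [norm_mul]
      exact (mul_le_mul_of_nonneg_left (hPle w hw k) (norm_nonneg _)).trans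
        (norm_multipleZetaTerm_mul_pow_le hs' k.2.2)
  have hsplit (w : ℂ) (hw : w ∈ U) :
      (∑' k : StrictMonoPosTuple (r + 1), multipleZetaTerm s k.1) * riemannZeta w -
        ∑' k, multipleZetaTerm s k.1 * P k w =
      ∑' k, multipleZetaTerm s k.1 * (riemannZeta w - P k w) := by
    rw [← tsum_mul_right, ← ((summable_multipleZetaTerm hs2).mul_right _).tsum_sub
      (summable_multipleZetaTerm_mul hs' (hPle w hw))]
    simp only [mul_sub]
  have hmem : (-(n : ℂ)) ∈ U := by simp [hU]
  have hana := analyticAt_riemannZeta (neg_natCast_ne_one n)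
  refine ⟨-((n : ℝ) + 1), 2, fun w =>
    (∑' k : StrictMonoPosTuple (r + 1), multipleZetaTerm s k.1) * riemannZeta w -
        ∑' k, multipleZetaTerm s k.1 * P k w, hmem, fun w hw => ?_, fun w hw => ?_, ?_, ?_⟩
  · exact ((MeromorphicAt.const _ w).mul (meromorphicAt_riemannZeta w)).sub
      (hdiff.analyticAt (hUo.mem_nhds hw)).meromorphicAt
  · refine (hsplit w ?_).trans (multipleZeta_snoc hs2 hw.le).symm
    have : (-((n : ℝ) + 1)) < w.re := by linarith
    exact this
  · exact (analyticAt_const.mul hana).sub (hdiff.analyticAt (hUo.mem_nhds hmem))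
  · refine (hsplit _ hmem).trans (tsum_congr fun k => ?_)
    simp [hP]

/-! ### Reduction to smaller depth -/

/-- Faulhaber's formula gives the terms $j\le n$, and $\zeta(-n)=-B'_{n+1}/(n+1)$ is exactly the
missing constant term $j=n+1$. The sum includes $m=K$, hence `bernoulli'`. -/
theorem riemannZeta_neg_nat_sub_sum_pow (n K : ℕ) :
    riemannZeta (-n) - ∑ m ∈ Finset.Ico 1 (K + 1), (m : ℂ) ^ n =
      ∑ j ∈ Finset.range (n + 2),
        ((-(bernoulli' j * (n + 1).choose j / (n + 1 : ℕ)) : ℚ) : ℂ) * (K : ℂ) ^ (n + 1 - j) := by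
  have h := congrArg (Rat.cast : ℚ → ℂ) (sum_Ico_pow K n)
  push_cast at h
  rw [h, riemannZeta_neg_nat_eq_bernoulli', Finset.sum_range_succ _ (n + 1), sub_eq_add_neg,
    add_comm, ← Finset.sum_neg_distrib]
  push_cast
  congr 1
  · refine Finset.sum_congr rfl fun j _ => ?_
    ring
  · simp
    ring

theorem multipleZetaTerm_mul_pow {r : ℕ} (s : Fin (r + 1) → ℂ) {k : Fin (r + 1) → ℕ}
    (hk : ∀ i, 0 < k i) (p : ℕ) :
    multipleZetaTerm s k * (k (Fin.last r) : ℂ) ^ p =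
      multipleZetaTerm (fun i => s i - if i = Fin.last r then (p : ℂ) else 0) k := by
  have h0 : (k (Fin.last r) : ℂ) ≠ 0 := Nat.cast_ne_zero.mpr (hk _).ne'
  simp only [multipleZetaTerm, Fin.prod_univ_castSucc, (Fin.castSucc_lt_last _).ne, if_false,
    if_true, sub_zero]
  rw [mul_assoc, neg_sub, sub_eq_neg_add, Complex.cpow_add _ _ h0, Complex.cpow_natCast]

theorem tsum_multipleZetaTerm_mul_sub {r : ℕ} {s : Fin (r + 1) → ℂ} (n : ℕ)
    (hs : ∀ i, (n : ℝ) + 4 ≤ (s i).re) :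
    ∑' k : StrictMonoPosTuple (r + 1), multipleZetaTerm s k.1 *
        (riemannZeta (-n) - ∑ m ∈ Finset.Ico 1 (k.1 (Fin.last r) + 1), (m : ℂ) ^ n) =
      ∑ j ∈ Finset.range (n + 2),
        ((-(bernoulli' j * (n + 1).choose j / (n + 1 : ℕ)) : ℚ) : ℂ) *
          multipleZeta (r + 1)
            (fun i => s i - if i = Fin.last r then ((n + 1 - j : ℕ) : ℂ) else 0) := by
  have hsum (p : ℕ) (hp : p ≤ n + 1) (c : ℂ) : Summable fun k : StrictMonoPosTuple (r + 1) =>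
      multipleZetaTerm s k.1 * (c * (k.1 (Fin.last r) : ℂ) ^ p) := by
    simp only [mul_left_comm _ c]
    refine (summable_multipleZetaTerm_mul (p := p) (fun i => ?_) fun k => by simp).mul_left c
    have : (p : ℝ) ≤ n + 1 := by exact_mod_cast hp
    linarith [hs i]
  simp only [riemannZeta_neg_nat_sub_sum_pow, Finset.mul_sum]
  rw [Summable.tsum_finsetSum fun j _ => hsum _ (by omega) _]
  refine Finset.sum_congr rfl fun j _ => ?_
  rw [tsum_congr fun k => mul_left_comm _ _ _, tsum_mul_left]
  congr 1
  exact tsum_congr fun k => multipleZetaTerm_mul_pow s k.2.2 _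

/-! ### Induction on the depth -/

theorem multipleZeta_one {s : Fin 1 → ℂ} (hs : 1 < (s 0).re) :
    multipleZeta 1 s = riemannZeta (s 0) := by
  let e : ℕ ≃ StrictMonoPosTuple 1 :=
    { toFun := fun m => ⟨fun _ => m + 1, Subsingleton.strictMono _, fun _ => m.succ_pos⟩
      invFun := fun k => k.1 0 - 1
      left_inv := fun m => rfl
      right_inv := fun k => by
        ext i
        have := k.2.2 0
        rw [Subsingleton.elim i 0]
        simp only
        omega }
  rw [zeta_eq_tsum_one_div_nat_add_one_cpow hs, multipleZeta, ← e.tsum_eq]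
  refine tsum_congr fun m => ?_
  simp [e, Complex.cpow_neg]

theorem raabeZeta_eq_raabeSum {d : ℕ} (n : Fin (d + 1) → ℕ) :
    raabeZeta n = (-1) ^ (∑ i, n i) * raabeSum n := rfl

theorem sum_mergeLast {d : ℕ} (n : Fin (d + 2) → ℕ) (a : ℕ) :
    ∑ i, mergeLast n a i = ∑ i : Fin (d + 1), n i.castSucc + a := by
  simp [mergeLast, Finset.sum_add_distrib]

/-- Here $B'_j=(-1)^jB_j$ absorbs the signs: with $a=n_r+1-j$, $(-1)^{n_r}=-(-1)^j(-1)^a$, and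
$(-1)^a$ belongs to the merged exponents. -/
theorem raabeZeta_succ {d : ℕ} (n : Fin (d + 2) → ℕ) :
    raabeZeta n = ∑ j ∈ Finset.range (n (Fin.last (d + 1)) + 2),
      -(bernoulli' j * (n (Fin.last (d + 1)) + 1).choose j / (n (Fin.last (d + 1)) + 1 : ℕ)) *
        raabeZeta (mergeLast n (n (Fin.last (d + 1)) + 1 - j)) := by
  rw [raabeZeta_eq_raabeSum, raabeSum_succ, Finset.mul_sum]
  refine Finset.sum_congr rfl fun j hj => ?_
  obtain ⟨a, ha⟩ : ∃ a, n (Fin.last (d + 1)) + 1 = j + a :=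
    ⟨_, (Nat.add_sub_of_le (Nat.le_of_lt_succ (Finset.mem_range.mp hj))).symm⟩
  have hsign : (-1 : ℚ) ^ n (Fin.last (d + 1)) = -((-1) ^ j * (-1) ^ a) := by
    rw [← pow_add, ← ha, pow_succ]
    ring
  rw [raabeZeta_eq_raabeSum, sum_mergeLast, bernoulli'_eq_bernoulli, Fin.sum_univ_castSucc,
    pow_add, pow_add, hsign, show n (Fin.last (d + 1)) + 1 - j = a by omega]
  ring

theorem raabeZeta_zero (n : Fin 1 → ℕ) : ((raabeZeta n : ℚ) : ℂ) = riemannZeta (-(n 0 : ℂ)) := by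
  rw [raabeZeta_eq_raabeSum, raabeSum_zero, riemannZeta_neg_nat_eq_bernoulli]
  push_cast
  simp
  ring

theorem hasIteratedContinuationValue_multipleZeta (d : ℕ) (n : Fin (d + 1) → ℕ) :
    HasIteratedContinuationValue (d + 1) (multipleZeta (d + 1)) (fun i => -(n i : ℂ))
      ((raabeZeta n : ℚ) : ℂ) := by
  induction d with
  | zero =>
    refine ⟨0, fun _ => riemannZeta (-(n 0 : ℂ)), fun s _ => ?_, (raabeZeta_zero n).symm⟩
    refine ⟨-(n 0 : ℝ) - 1, 1, riemannZeta, by simp, fun w _ => meromorphicAt_riemannZeta w,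
      fun w hw => ?_, analyticAt_riemannZeta (neg_natCast_ne_one _), rfl⟩
    have h : Fin.snoc (α := fun _ => ℂ) s w 0 = w := Fin.snoc_last (α := fun _ => ℂ) w s
    exact ((multipleZeta_one (by rwa [h])).trans (by rw [h])).symm
  | succ d ih =>
    refine ⟨(n (Fin.last (d + 1)) : ℝ) + 4, fun s => ∑ j ∈ Finset.range (n (Fin.last (d + 1)) + 2),
        ((-(bernoulli' j * (n (Fin.last (d + 1)) + 1).choose j /
          (n (Fin.last (d + 1)) + 1 : ℕ)) : ℚ) : ℂ) * multipleZeta (d + 1) (fun i =>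
            s i - if i = Fin.last d then ((n (Fin.last (d + 1)) + 1 - j : ℕ) : ℂ) else 0),
      fun s hs => ?_, ?_⟩
    · have h := hasContinuationValue_multipleZeta_snoc _ fun i => (hs i).le
      rwa [tsum_multipleZetaTerm_mul_sub _ fun i => (hs i).le] at h
    · rw [raabeZeta_succ, Rat.cast_sum]
      refine .sum _ fun j _ => ?_
      rw [Rat.cast_mul]
      -- Shifting the last variable moves the evaluation point to the negative of the merged
      -- exponents, where the induction hypothesis applies.
      refine .const_mul _ (.comp_sub_last _ ?_)
      convert ih (mergeLast n (n (Fin.last (d + 1)) + 1 - j)) using 2 with i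
      simp only [mergeLast]
      split_ifs <;> push_cast <;> ring

theorem mainTheorem4 (d : ℕ) (n : Fin (d + 1) → ℕ) :
    renormH d n = (-1) ^ (∑ i, n i) * raabeZeta n ∧
    ∀ v : ℂ, HasIteratedContinuationValue (d + 1) (multipleZeta (d + 1)) (fun i => -(n i : ℂ)) v ↔
      v = ((raabeZeta n : ℚ) : ℂ) := by
  refine ⟨?_, fun v => ⟨fun h => h.unique (hasIteratedContinuationValue_multipleZeta d n), ?_⟩⟩
  · rw [renormH_eq_raabeSum, raabeZeta_eq_raabeSum, ← mul_assoc, ← mul_pow]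
    simp
  · rintro rfl
    exact hasIteratedContinuationValue_multipleZeta d n
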